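/- Let $g \ge 0$. Let $V_g$ be the handlebody of genus $g$ and $S_g = \partial V_g$ its boundary surface. Let $\mathrm{Mod}(V_g)$ and $\mathrm{Mod}(S_g)$ be the groups of isotopy classes of orientation-preserving homeomorphisms of $V_g$ and of $S_g$. Restriction to the boundary gives a homomorphism $\iota\colon \mathrm{Mod}(V_g) \to \mathrm{Mod}(S_g)$. The actions on fundamental groups give homomorphisms $\mathrm{Mod}(S_g) \to \mathrm{Out}(\pi_1(S_g))$ and $\pi\colon \mathrm{Mod}(V_g) \to \mathrm{Out}(\pi_1(V_g)) \cong \mathrm{Out}(F_g)$, where $F_g$ is the free group of rank $g$ and $\pi_1(V_g)$ is identified with $F_g$ by any isomorphism. For a group $G$ with a finite generating set $A$, let $\|w\|_A$ be the conjugacy length of $w \in G$, that is, the least word length with respect to $A$ of an element of the conjugacy class of $w$. For $\Phi \in \mathrm{Out}(G)$ let $$\mathrm{EG}_A(\Phi) = \sup_{w \in G}\ \limsup_{n \to \infty} \sqrt[n]{\|\Phi^n(w)\|_A}$$ be its exponential growth rate. Then the projection $\pi$ does not increase growth rates: for every $f \in \mathrm{Mod}(V_g)$, every finite generating set $A$ of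 $\pi_1(S_g)$ and every finite generating set $B$ of $F_g$, $$\mathrm{EG}_B(\pi(f)) \le \mathrm{EG}_A(\iota(f)),$$ where $\iota(f)$ is regarded as an element of $\mathrm{Out}(\pi_1(S_g))$. The same inequality holds for the image of $f$ in $\mathrm{Out}(\pi_1(V_g))$ and every finite generating set $B$ of $\pi_1(V_g)$, without an identification of this group with $F_g$. -/

import Mathlib

open scoped unitInterval ENNReal
open CategoryTheory

/-! ### Outer automorphisms -/

section GroupTheory

variable {G H : Type*} [Group G] [Group H]

instance innNormal (G : Type*) [Group G] : (MulAut.conj : G →* MulAut G).range.Normal where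
  conj_mem := by
    rintro _ ⟨x, rfl⟩ φ
    refine ⟨φ x, ?_⟩
    ext y
    simp [MulAut.conj_apply]

/-- The outer automorphism group `Out(G) = Aut(G) / Inn(G)`. -/
abbrev Out (G : Type*) [Group G] : Type _ :=
  MulAut G ⧸ (MulAut.conj : G →* MulAut G).range

/-- The permutation of the conjugacy classes of `G` given by an automorphism of `G`. -/
def autConjClasses (G : Type*) [Group G] : MulAut G →* Equiv.Perm (ConjClasses G) where
  toFun φ :=
    { toFun := ConjClasses.map φ.toMonoidHom
      invFun := ConjClasses.map φ.symm.toMonoidHom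
      left_inv := by rintro ⟨x⟩; exact congrArg ConjClasses.mk (φ.symm_apply_apply x)
      right_inv := by rintro ⟨x⟩; exact congrArg ConjClasses.mk (φ.apply_symm_apply x) }
  map_one' := by ext ⟨x⟩; rfl
  map_mul' φ ψ := by ext ⟨x⟩; rfl

/-- The action of `Out(G)` on the conjugacy classes of `G`:
the class of `φ` sends the conjugacy class of `w` to that of `φ w`. -/
def outConjClasses (G : Type*) [Group G] : Out G →* Equiv.Perm (ConjClasses G) :=
  QuotientGroup.lift _ (autConjClasses G) (by
    rintro _ ⟨x, rfl⟩
    ext ⟨y⟩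
    refine ConjClasses.mk_eq_mk_iff_isConj.2 (isConj_iff.2 ⟨x⁻¹, ?_⟩)
    change x⁻¹ * (x * y * x⁻¹) * x⁻¹⁻¹ = y
    group)

/-- The isomorphism `Out(G) ≅ Out(H)` induced by an isomorphism `e : G ≅ H`, as a homomorphism:
the class of `φ` is sent to the class of `e ∘ φ ∘ e⁻¹`. -/
def outCongr (e : G ≃* H) : Out G →* Out H :=
  QuotientGroup.map _ _ (MulAut.congr e).toMonoidHom (by
    rintro _ ⟨x, rfl⟩
    refine ⟨e x, ?_⟩
    ext y
    simp [MulAut.congr])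

/-! ### Conjugacy length and exponential growth -/

/-- The word length of `w` with respect to `A`: the least length of a word in the letters
`a`, `a⁻¹` (`a ∈ A`) which represents `w`. -/
noncomputable def wordLength (A : Set G) (w : G) : ℕ :=
  sInf {n | ∃ l : List G, (∀ a ∈ l, a ∈ A ∨ a⁻¹ ∈ A) ∧ l.prod = w ∧ l.length = n}

/-- The conjugacy length: the least word length of an element of the conjugacy class `c`. -/
noncomputable def conjLength (A : Set G) (c : ConjClasses G) : ℕ :=
  sInf (wordLength A '' c.carrier)

/-- The exponential growth rate `sup_w limsup_n ‖Φⁿ(w)‖ ^ (1/n)` of `Φ ∈ Out(G)`, where `‖·‖` is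
the conjugacy length with respect to the generating set `A`. -/
noncomputable def expGrowth (A : Set G) (Φ : Out G) : ℝ≥0∞ :=
  ⨆ w : G, Filter.limsup
    (fun n : ℕ =>
      (conjLength A (outConjClasses G (Φ ^ n) (ConjClasses.mk w)) : ℝ≥0∞) ^ ((1 : ℝ) / n))
    Filter.atTop

end GroupTheory

/-! ### Mapping class groups -/

section MappingClassGroup

variable {X : Type*} [TopologicalSpace X]

/-- The elements of a group `K` of homeomorphisms which are isotopic to the identity, through
homeomorphisms which lie in `K`. -/
def isotopicToId (K : Subgroup (X ≃ₜ X)) : Subgroup K where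
  carrier := {h | ∃ F : C(I × X, X), (∀ t, ∃ k ∈ K, ∀ x, F (t, x) = k x) ∧
    (∀ x, F (0, x) = x) ∧ ∀ x, F (1, x) = h.1 x}
  one_mem' := ⟨⟨Prod.snd, continuous_snd⟩, fun _ => ⟨1, K.one_mem, fun _ => rfl⟩,
    fun _ => rfl, fun _ => rfl⟩
  mul_mem' := by
    rintro a b ⟨F, hF, hF0, hF1⟩ ⟨E, hE, hE0, hE1⟩
    refine ⟨⟨fun p => F (p.1, E p), by fun_prop⟩, fun t => ?_, fun x => ?_, fun x => ?_⟩
    · obtain ⟨k, hk, hk'⟩ := hF t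
      obtain ⟨l, hl, hl'⟩ := hE t
      exact ⟨k * l, K.mul_mem hk hl, fun x => by simp [hk', hl']⟩
    · simp [hF0, hE0]
    · simp [hF1, hE1]
  inv_mem' := by
    rintro a ⟨F, hF, hF0, hF1⟩
    refine ⟨⟨fun p => F (unitInterval.symm p.1, a.1.symm p.2), by fun_prop⟩,
      fun t => ?_, fun x => ?_, fun x => ?_⟩
    · obtain ⟨k, hk, hk'⟩ := hF (unitInterval.symm t)
      exact ⟨k * a.1⁻¹, K.mul_mem hk (K.inv_mem a.2), fun x => by simp [hk']⟩
    · simp [hF1]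
    · simp [hF0]

instance isotopicToId_normal (K : Subgroup (X ≃ₜ X)) : (isotopicToId K).Normal where
  conj_mem := by
    rintro a ⟨F, hF, hF0, hF1⟩ g
    refine ⟨⟨fun p => g.1 (F (p.1, g.1.symm p.2)), by fun_prop⟩,
      fun t => ?_, fun x => ?_, fun x => ?_⟩
    · obtain ⟨k, hk, hk'⟩ := hF t
      exact ⟨g.1 * k * g.1⁻¹, K.mul_mem (K.mul_mem g.2 hk) (K.inv_mem g.2),
        fun x => by simp [hk']⟩
    · simp [hF0]
    · simp [hF1]

/-- The group of isotopy classes of elements of a group `K` of homeomorphisms. -/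
abbrev MCG (K : Subgroup (X ≃ₜ X)) : Type _ := K ⧸ isotopicToId K

/-! ### The action on the fundamental group -/

theorem homeo_map_bijective (h : X ≃ₜ X) (a b : FundamentalGroupoid X) :
    Function.Bijective (fun p : a ⟶ b => (FundamentalGroupoid.map (h : C(X, X))).map p) := by
  have e : (FundamentalGroupoid.map (h : C(X, X))).IsEquivalence :=
    (FundamentalGroupoidFunctor.equivOfHomotopyEquiv h.toHomotopyEquiv).isEquivalence_functor
  exact (Functor.FullyFaithful.ofFullyFaithful (FundamentalGroupoid.map (h : C(X, X)))).map_bijective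
    a b

/-- The automorphism `p ↦ γ⁻¹ · h(p) · γ` of `π₁(X, x)` given by a homeomorphism `h` and a class
`γ` of paths from `h x` to `x` (concatenation of paths is written from left to right). -/
noncomputable def homeoAut {x : X} (h : X ≃ₜ X)
    (γ : FundamentalGroupoid.mk (h x) ⟶ FundamentalGroupoid.mk x) :
    MulAut (FundamentalGroup X x) :=
  MulEquiv.ofBijective
    (((Groupoid.isoEquivHom _ _).symm γ).conj.toMonoidHom.comp
      (FundamentalGroup.map (h : C(X, X)) x))
    (((Groupoid.isoEquivHom _ _).symm γ).conj.bijective.comp (homeo_map_bijective h _ _))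

theorem homeoAut_apply {x : X} (h : X ≃ₜ X)
    (γ : FundamentalGroupoid.mk (h x) ⟶ FundamentalGroupoid.mk x) (p : FundamentalGroup X x) :
    homeoAut h γ p =
      (Groupoid.inv γ ≫ (FundamentalGroupoid.map (h : C(X, X))).map p ≫ γ :) := rfl

theorem conj_eq {x : X} (c p : FundamentalGroup X x) :
    c * p * c⁻¹ = (Groupoid.inv c ≫ p ≫ c :) := rfl

theorem groupoid_aux₁ {C : Type*} [Groupoid C] {a b : C} (q : a ⟶ a) (γ δ : a ⟶ b) :
    Groupoid.inv δ ≫ q ≫ δ =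
      Groupoid.inv (Groupoid.inv γ ≫ δ) ≫ (Groupoid.inv γ ≫ q ≫ γ) ≫ Groupoid.inv γ ≫ δ := by
  simp

theorem groupoid_aux₂ {C D : Type*} [Groupoid C] [Groupoid D] (F : C ⥤ D) {a b : C} {c : D}
    (p : a ⟶ a) (γ : a ⟶ b) (δ : F.obj b ⟶ c) :
    Groupoid.inv (F.map γ ≫ δ) ≫ F.map p ≫ F.map γ ≫ δ =
      Groupoid.inv δ ≫ F.map (Groupoid.inv γ ≫ p ≫ γ) ≫ δ := by
  simp

theorem groupoid_aux₃ {C : Type*} [Groupoid C] {a b : C} {p : a ⟶ a} {q : b ⟶ b} {τ : a ⟶ b}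
    (h : p ≫ τ = τ ≫ q) : Groupoid.inv (Groupoid.inv τ) ≫ q ≫ Groupoid.inv τ = p := by
  have h' : q = inv τ ≫ p ≫ τ := by simp [h]
  simp [h']

theorem groupoid_aux₄ {C : Type*} [Groupoid C] {a : C} {p q : a ⟶ a} (h : q = p) :
    Groupoid.inv (𝟙 a) ≫ q ≫ 𝟙 a = p := by
  simp [h]

theorem groupoid_map_id {a b : X} (p : FundamentalGroupoid.mk a ⟶ FundamentalGroupoid.mk b) :
    (FundamentalGroupoid.map (ContinuousMap.id X)).map p = p := by
  induction p using Path.Homotopic.Quotient.ind with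
  | mk p => rfl

theorem groupoid_map_comp (f g : C(X, X)) {a b : X}
    (p : FundamentalGroupoid.mk a ⟶ FundamentalGroupoid.mk b) :
    (FundamentalGroupoid.map (f.comp g)).map p =
      (FundamentalGroupoid.map f).map ((FundamentalGroupoid.map g).map p) := by
  induction p using Path.Homotopic.Quotient.ind with
  | mk p => rfl

theorem outer_eq {G : Type*} [Group G] {φ ψ : MulAut G} (c : G)
    (h : ∀ p, ψ p = c * φ p * c⁻¹) : (φ : Out G) = ψ := by
  have : ψ = MulAut.conj c * φ := by
    ext p
    simp [h]
  have h1 : ((MulAut.conj c : MulAut G) : Out G) = 1 :=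
    (QuotientGroup.eq_one_iff (MulAut.conj c)).2 (MonoidHom.mem_range.2 ⟨c, rfl⟩)
  rw [this, QuotientGroup.mk_mul, h1, one_mul]

theorem homeoAut_outer_eq {x : X} (h : X ≃ₜ X)
    (γ δ : FundamentalGroupoid.mk (h x) ⟶ FundamentalGroupoid.mk x) :
    (homeoAut h γ : Out (FundamentalGroup X x)) = homeoAut h δ := by
  refine outer_eq (Groupoid.inv γ ≫ δ : FundamentalGroup X x) fun p => ?_
  rw [homeoAut_apply, homeoAut_apply, conj_eq]
  exact groupoid_aux₁ _ _ _

/-- The class of a path, as an arrow of the fundamental groupoid. -/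
def pathArrow {a b : X} (γ : Path a b) : FundamentalGroupoid.mk a ⟶ FundamentalGroupoid.mk b :=
  Path.Homotopic.Quotient.mk γ

/-- The homomorphism `Homeo(X) → Out(π₁(X, x))`: a homeomorphism `h` acts by
`p ↦ γ⁻¹ · h(p) · γ`, where `γ` is any path from `h x` to `x`. -/
noncomputable def homeoOut [PathConnectedSpace X] (x : X) :
    (X ≃ₜ X) →* Out (FundamentalGroup X x) where
  toFun h := (homeoAut h (pathArrow (PathConnectedSpace.somePath (h x) x)) :
    MulAut (FundamentalGroup X x))
  map_one' := by
    refine (homeoAut_outer_eq _ _ (𝟙 (FundamentalGroupoid.mk x))).trans ?_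
    refine congrArg (QuotientGroup.mk (s := (MulAut.conj (G := FundamentalGroup X x)).range))
      (MulEquiv.ext (g := 1) fun p => ?_)
    refine (homeoAut_apply _ _ _).trans ?_
    exact groupoid_aux₄ (groupoid_map_id p)
  map_mul' h k := by
    refine (homeoAut_outer_eq (h * k) _
      ((FundamentalGroupoid.map (h : C(X, X))).map
        (pathArrow (PathConnectedSpace.somePath (k x) x)) ≫
          pathArrow (PathConnectedSpace.somePath (h x) x))).trans ?_
    refine congrArg (QuotientGroup.mk (s := (MulAut.conj (G := FundamentalGroup X x)).range))
      (MulEquiv.ext (g := _ * _) fun p => ?_)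
    rw [MulAut.mul_apply, homeoAut_apply, homeoAut_apply, homeoAut_apply]
    refine Eq.trans ?_ (groupoid_aux₂ (FundamentalGroupoid.map (h : C(X, X))) _ _ _)
    have h1 := groupoid_map_comp (h : C(X, X)) (k : C(X, X)) p
    exact congrArg (fun q => Groupoid.inv _ ≫ q ≫ _) h1

theorem homeoOut_eq_one [PathConnectedSpace X] (x : X) (K : Subgroup (X ≃ₜ X)) (h : K)
    (hh : h ∈ isotopicToId K) : homeoOut x h.1 = 1 := by
  obtain ⟨F, hF, hF0, hF1⟩ := hh
  let E : ContinuousMap.Homotopy (ContinuousMap.id X) (h.1 : C(X, X)) :=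
    ⟨F, hF0, hF1⟩
  refine (homeoAut_outer_eq _ _ (Groupoid.inv (pathArrow (E.evalAt x)))).trans ?_
  refine congrArg (QuotientGroup.mk (s := (MulAut.conj (G := FundamentalGroup X x)).range))
    (MulEquiv.ext (g := 1) fun p => ?_)
  have nat := (FundamentalGroupoidFunctor.homotopicMapsNatIso E).naturality p
  exact (homeoAut_apply _ _ _).trans (groupoid_aux₃ ((congrArg (· ≫ _) (groupoid_map_id p)).symm.trans nat))

/-- The action of a mapping class on the fundamental group, up to inner automorphisms. -/
noncomputable def mcgOut [PathConnectedSpace X] (K : Subgroup (X ≃ₜ X)) (x : X) :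
    MCG K →* Out (FundamentalGroup X x) :=
  QuotientGroup.lift (isotopicToId K) ((homeoOut x).comp K.subtype)
    (fun h hh => homeoOut_eq_one x K h hh)

end MappingClassGroup

/-! ### Handlebodies and their boundary surfaces -/

/-- The planar region `P_g`: the closed disc of radius `4 (g + 1)` about the origin, minus the `g`
disjoint open unit discs about the points `(4, 0), (8, 0), …, (4 g, 0)` of its interior. -/
def planarDomain (g : ℕ) : Set (ℝ × ℝ) :=
  {p | p.1 ^ 2 + p.2 ^ 2 ≤ (4 * ((g : ℝ) + 1)) ^ 2 ∧
    ∀ i < g, 1 ≤ (p.1 - 4 * ((i : ℝ) + 1)) ^ 2 + p.2 ^ 2}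

/-- A smooth function which is positive in the interior of `P_g`, and which vanishes on the
boundary circles of `P_g` with non-zero gradient. -/
def planarHeight (g : ℕ) (p : ℝ × ℝ) : ℝ :=
  ((4 * ((g : ℝ) + 1)) ^ 2 - (p.1 ^ 2 + p.2 ^ 2)) *
    ∏ i ∈ Finset.range g, ((p.1 - 4 * ((i : ℝ) + 1)) ^ 2 + p.2 ^ 2 - 1)

/-- The handlebody `V_g` of genus `g`: the thickening
`{(p, z) | p ∈ P_g, z² ≤ q(p)}` in `ℝ³` of the disc with `g` holes `P_g`, where `q` is
`planarHeight g`. -/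
abbrev Handlebody (g : ℕ) : Type :=
  {v : (ℝ × ℝ) × ℝ // v.1 ∈ planarDomain g ∧ v.2 ^ 2 ≤ planarHeight g v.1}

/-- The boundary `∂V_g` in `V_g`, given by the equation `z² = q(p)`. -/
def handlebodyBoundary (g : ℕ) : Set (Handlebody g) :=
  {v | v.1.2 ^ 2 = planarHeight g v.1.1}

/-- The closed oriented surface `S_g = ∂V_g` of genus `g`. -/
abbrev Surface (g : ℕ) : Type := handlebodyBoundary g

theorem continuous_planarHeight (g : ℕ) : Continuous (planarHeight g) := by
  unfold planarHeight
  fun_prop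

theorem planarHeight_nonneg {g : ℕ} {p : ℝ × ℝ} (hp : p ∈ planarDomain g) :
    0 ≤ planarHeight g p :=
  mul_nonneg (sub_nonneg.2 hp.1)
    (Finset.prod_nonneg fun i hi => sub_nonneg.2 (hp.2 i (Finset.mem_range.1 hi)))

theorem planarDomain_isPathConnected (g : ℕ) : IsPathConnected (planarDomain g) := by
  set R : ℝ := 4 * ((g : ℝ) + 1) with hR
  have hg : (0 : ℝ) ≤ g := Nat.cast_nonneg g
  have hR0 : 4 ≤ R := by linarith
  have hole : ∀ x y : ℝ, x ^ 2 + y ^ 2 = R ^ 2 → ∀ i < g,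
      1 ≤ (x - 4 * ((i : ℝ) + 1)) ^ 2 + y ^ 2 := by
    intro x y hxy i hi
    have hi' : (i : ℝ) + 1 ≤ g := by exact_mod_cast hi
    have hi0 : (0 : ℝ) ≤ i := Nat.cast_nonneg i
    have hx : x ≤ R := by nlinarith [sq_nonneg y]
    nlinarith
  -- the upper half and its mirror image
  have main : ∀ s : ℝ, s ^ 2 = 1 → ∀ x y : ℝ, 0 ≤ y → (x, s * y) ∈ planarDomain g →
      JoinedIn (planarDomain g) (R, 0) (x, s * y) := by
    intro s hs x y hy hxy
    have hs' : ∀ y : ℝ, (s * y) ^ 2 = y ^ 2 := fun y => by rw [mul_pow, hs, one_mul]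
    have hxy1 : x ^ 2 + y ^ 2 ≤ R ^ 2 := by have := hxy.1; rwa [hs'] at this
    have hxy2 : ∀ i < g, 1 ≤ (x - 4 * ((i : ℝ) + 1)) ^ 2 + y ^ 2 := by
      intro i hi
      have := hxy.2 i hi
      rwa [hs'] at this
    have hxR : x ^ 2 ≤ R ^ 2 := by nlinarith [sq_nonneg y]
    have hxabs := abs_le.1 (abs_le_of_sq_le_sq hxR (by linarith))
    have hyle : y ≤ √(R ^ 2 - x ^ 2) := Real.le_sqrt_of_sq_le (by linarith)
    have arc : JoinedIn (planarDomain g) (R, 0) (x, s * √(R ^ 2 - x ^ 2)) := by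
      refine JoinedIn.ofLine (f := fun t : ℝ =>
        (R + t * (x - R), s * √(R ^ 2 - (R + t * (x - R)) ^ 2))) (by fun_prop)
        (by simp) (by simp) ?_
      rintro _ ⟨t, ht, rfl⟩
      have hb : (R + t * (x - R)) ^ 2 ≤ R ^ 2 := by
        apply sq_le_sq' <;> nlinarith [ht.1, ht.2]
      have he : (R + t * (x - R)) ^ 2 + (s * √(R ^ 2 - (R + t * (x - R)) ^ 2)) ^ 2 = R ^ 2 := by
        rw [hs', Real.sq_sqrt (by linarith)]
        ring
      exact ⟨he.le, hole _ _ he⟩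
    have seg : JoinedIn (planarDomain g) (x, s * √(R ^ 2 - x ^ 2)) (x, s * y) := by
      refine JoinedIn.ofLine (f := fun t : ℝ =>
        (x, s * (√(R ^ 2 - x ^ 2) + t * (y - √(R ^ 2 - x ^ 2))))) (by fun_prop)
        (by simp) (by simp) ?_
      rintro _ ⟨t, ht, rfl⟩
      set r := √(R ^ 2 - x ^ 2) with hr
      have hr2 : r ^ 2 = R ^ 2 - x ^ 2 := Real.sq_sqrt (by linarith)
      have h1 : y ≤ r + t * (y - r) := by nlinarith [ht.1, ht.2]
      have h2 : r + t * (y - r) ≤ r := by nlinarith [ht.1, ht.2]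
      have h3 : y ^ 2 ≤ (r + t * (y - r)) ^ 2 := pow_le_pow_left₀ hy h1 2
      have h4 : (r + t * (y - r)) ^ 2 ≤ r ^ 2 := pow_le_pow_left₀ (hy.trans h1) h2 2
      refine ⟨?_, fun i hi => ?_⟩
      · change x ^ 2 + (s * (r + t * (y - r))) ^ 2 ≤ R ^ 2
        rw [hs']
        linarith
      · change 1 ≤ (x - 4 * ((i : ℝ) + 1)) ^ 2 + (s * (r + t * (y - r))) ^ 2
        rw [hs']
        linarith [hxy2 i hi]
    exact arc.trans seg
  refine ⟨(R, 0), ?_, ?_⟩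
  · have he : R ^ 2 + (0 : ℝ) ^ 2 = R ^ 2 := by ring
    exact ⟨he.le, hole _ _ he⟩
  · rintro ⟨x, y⟩ hxy
    rcases le_total 0 y with hy | hy
    · have := main 1 (by norm_num) x y hy (by simpa using hxy)
      simpa using this
    · have := main (-1) (by norm_num) x (-y) (by linarith) (by simpa using hxy)
      simpa using this

/-- The point of `V_g` over `p ∈ P_g` at the fraction `s ∈ [-1, 1]` of the greatest height. -/
noncomputable def sheet (g : ℕ) (a : planarDomain g × Set.Icc (-1 : ℝ) 1) : Handlebody g :=
  ⟨(a.1.1, a.2.1 * √(planarHeight g a.1.1)), a.1.2, by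
    have h1 : (a.2.1 : ℝ) ^ 2 ≤ 1 := by nlinarith [a.2.2.1, a.2.2.2]
    have h2 := planarHeight_nonneg a.1.2
    simp only [mul_pow, Real.sq_sqrt h2]
    nlinarith⟩

theorem continuous_sheet (g : ℕ) : Continuous (sheet g) := by
  have := continuous_planarHeight g
  unfold sheet
  fun_prop

theorem sheet_surjective (g : ℕ) : Function.Surjective (sheet g) := by
  rintro ⟨⟨p, z⟩, hp, hz⟩
  have hq := planarHeight_nonneg hp
  have hz' : |z| ≤ √(planarHeight g p) := Real.abs_le_sqrt hz
  rcases eq_or_ne (√(planarHeight g p)) 0 with h0 | h0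
  · refine ⟨(⟨p, hp⟩, ⟨0, by simp⟩), Subtype.ext (Prod.ext rfl ?_)⟩
    rw [h0] at hz'
    simp [sheet, abs_nonpos_iff.1 hz']
  · have hpos : 0 < √(planarHeight g p) := lt_of_le_of_ne (Real.sqrt_nonneg _) h0.symm
    refine ⟨(⟨p, hp⟩, ⟨z / √(planarHeight g p), ?_⟩), Subtype.ext (Prod.ext rfl ?_)⟩
    · exact abs_le.1 (by rwa [abs_div, abs_of_pos hpos, div_le_one hpos])
    · exact div_mul_cancel₀ z h0

instance planarDomain_pathConnectedSpace (g : ℕ) : PathConnectedSpace (planarDomain g) :=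
  isPathConnected_iff_pathConnectedSpace.1 (planarDomain_isPathConnected g)

instance handlebody_pathConnected (g : ℕ) : PathConnectedSpace (Handlebody g) := by
  have : PathConnectedSpace (Set.Icc (-1 : ℝ) 1) :=
    isPathConnected_iff_pathConnectedSpace.1
      ((convex_Icc (-1 : ℝ) 1).isPathConnected ⟨0, by simp⟩)
  exact (sheet_surjective g).pathConnectedSpace (continuous_sheet g)

theorem handlebodyBoundary_eq (g : ℕ) : handlebodyBoundary g =
    Set.range (fun p => sheet g (p, ⟨1, by simp⟩)) ∪
      Set.range (fun p => sheet g (p, ⟨-1, by simp⟩)) := by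
  ext v
  constructor
  · intro hv
    have hv' : v.1.2 ^ 2 = planarHeight g v.1.1 := hv
    have h : √(planarHeight g v.1.1) = |v.1.2| := by rw [← hv', Real.sqrt_sq_eq_abs]
    rcases abs_choice v.1.2 with h1 | h1
    · refine Or.inl ⟨⟨v.1.1, v.2.1⟩, Subtype.ext (Prod.ext rfl ?_)⟩
      simp [sheet, h, h1]
    · refine Or.inr ⟨⟨v.1.1, v.2.1⟩, Subtype.ext (Prod.ext rfl ?_)⟩
      simp [sheet, h, h1]
  · rintro (⟨p, rfl⟩ | ⟨p, rfl⟩) <;>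
      simp [handlebodyBoundary, sheet, Real.sq_sqrt (planarHeight_nonneg p.2)]

instance surface_pathConnected (g : ℕ) : PathConnectedSpace (Surface g) := by
  have h := continuous_sheet g
  rw [← isPathConnected_iff_pathConnectedSpace, handlebodyBoundary_eq]
  refine (isPathConnected_range (by fun_prop)).union (isPathConnected_range (by fun_prop)) ?_
  have hc : ((4 * ((g : ℝ) + 1), 0) : ℝ × ℝ) ∈ planarDomain g := by
    refine ⟨by simp, fun i hi => ?_⟩
    have hi' : (i : ℝ) + 1 ≤ g := by exact_mod_cast hi
    nlinarith
  have hq : planarHeight g (4 * ((g : ℝ) + 1), 0) = 0 := by simp [planarHeight]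
  refine ⟨_, ⟨⟨_, hc⟩, rfl⟩, ⟨⟨_, hc⟩, ?_⟩⟩
  exact Subtype.ext (Prod.ext rfl (by simp [sheet, hq]))

/-! ### The groups `Mod(S_g)` and `Mod(V_g)` -/

/-- Singular homology in degree two, with integral coefficients. -/
noncomputable def homologyTwo : TopCat.{0} ⥤ ModuleCat.{0} ℤ :=
  (AlgebraicTopology.singularHomologyFunctor (ModuleCat.{0} ℤ) 2).obj (ModuleCat.of ℤ ℤ)

/-- The orientation-preserving homeomorphisms of `S_g`: those which act trivially on the singular
homology group `H₂(S_g; ℤ) ≅ ℤ`. -/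
noncomputable def surfaceHomeo (g : ℕ) : Subgroup (Surface g ≃ₜ Surface g) where
  carrier := {h | homologyTwo.map (TopCat.ofHom (h : C(Surface g, Surface g))) = 𝟙 _}
  one_mem' := homologyTwo.map_id (TopCat.of (Surface g))
  mul_mem' := by
    intro a b ha hb
    have h := homologyTwo.map_comp (TopCat.ofHom (b : C(Surface g, Surface g)))
      (TopCat.ofHom (a : C(Surface g, Surface g)))
    rw [Set.mem_ofPred_eq] at ha hb
    rw [ha, hb, Category.comp_id] at h
    exact h
  inv_mem' := by
    intro a ha
    have h := homologyTwo.map_comp (TopCat.ofHom (a : C(Surface g, Surface g)))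
      (TopCat.ofHom (a.symm : C(Surface g, Surface g)))
    rw [Set.mem_ofPred_eq] at ha
    rw [ha, Category.id_comp] at h
    refine h.symm.trans ?_
    rw [← TopCat.ofHom_comp]
    have : (a.symm : C(Surface g, Surface g)).comp (a : C(Surface g, Surface g)) =
        ContinuousMap.id _ := by ext1 x; exact a.symm_apply_apply x
    rw [this]
    exact homologyTwo.map_id _

/-- The restriction to `B` of a homeomorphism which preserves `B`. -/
def homeoRestrict {X : Type*} [TopologicalSpace X] {B : Set X} (h : X ≃ₜ X)
    (hB : ∀ x, x ∈ B ↔ h x ∈ B) : B ≃ₜ B :=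
  h.subtype hB

section Restrict

variable {X : Type*} [TopologicalSpace X] {B : Set X}

theorem homeoRestrict_one (hB : ∀ x, x ∈ B ↔ (1 : X ≃ₜ X) x ∈ B) : homeoRestrict 1 hB = 1 := rfl

theorem homeoRestrict_mul (h k : X ≃ₜ X) (hh : ∀ x, x ∈ B ↔ h x ∈ B) (hk : ∀ x, x ∈ B ↔ k x ∈ B)
    (hB : ∀ x, x ∈ B ↔ (h * k) x ∈ B) :
    homeoRestrict (h * k) hB = homeoRestrict h hh * homeoRestrict k hk := rfl

theorem homeoRestrict_inv (h : X ≃ₜ X) (hh : ∀ x, x ∈ B ↔ h x ∈ B)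
    (hB : ∀ x, x ∈ B ↔ h⁻¹ x ∈ B) :
    homeoRestrict h⁻¹ hB = (homeoRestrict h hh)⁻¹ := rfl

end Restrict

/-- The homeomorphisms of `V_g`, as a manifold with boundary (so that they preserve `∂V_g`), which
preserve the orientation. As `∂V_g` is connected and carries the boundary orientation, a
homeomorphism preserves the orientation of `V_g` if and only if its restriction to `∂V_g`
preserves that of `∂V_g`. -/
noncomputable def handlebodyHomeo (g : ℕ) : Subgroup (Handlebody g ≃ₜ Handlebody g) where
  carrier := {h | ∃ hB : ∀ v, v ∈ handlebodyBoundary g ↔ h v ∈ handlebodyBoundary g,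
    homeoRestrict h hB ∈ surfaceHomeo g}
  one_mem' := by
    refine ⟨fun _ => Iff.rfl, ?_⟩
    have h := (surfaceHomeo g).one_mem
    rwa [← homeoRestrict_one (X := Handlebody g) (fun _ => Iff.rfl)] at h
  mul_mem' := by
    rintro a b ⟨ha, ha'⟩ ⟨hb, hb'⟩
    refine ⟨fun v => (hb v).trans (ha (b v)), ?_⟩
    rw [homeoRestrict_mul a b ha hb]
    exact (surfaceHomeo g).mul_mem ha' hb'
  inv_mem' := by
    rintro a ⟨ha, ha'⟩
    refine ⟨fun v => by simpa using (ha (a.symm v)).symm, ?_⟩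
    rw [homeoRestrict_inv a ha]
    exact (surfaceHomeo g).inv_mem ha'

/-- The mapping class group `Mod(S_g)`. -/
abbrev ModS (g : ℕ) : Type := MCG (surfaceHomeo g)

/-- The handlebody group `Mod(V_g)`. -/
abbrev ModV (g : ℕ) : Type := MCG (handlebodyHomeo g)

/-- Restriction of homeomorphisms of `V_g` to the boundary. -/
noncomputable def restrictHom (g : ℕ) : handlebodyHomeo g →* surfaceHomeo g where
  toFun h := ⟨homeoRestrict h.1 h.2.fst, h.2.snd⟩
  map_one' := Subtype.ext (homeoRestrict_one _)
  map_mul' h k := Subtype.ext (homeoRestrict_mul h.1 k.1 h.2.fst k.2.fst _)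

theorem restrictHom_isotopic (g : ℕ) :
    isotopicToId (handlebodyHomeo g) ≤ (isotopicToId (surfaceHomeo g)).comap (restrictHom g) := by
  rintro h ⟨F, hF, hF0, hF1⟩
  have hm : ∀ p : I × Surface g, F (p.1, p.2.1) ∈ handlebodyBoundary g := by
    intro p
    obtain ⟨k, hk, hk'⟩ := hF p.1
    rw [hk']
    exact (hk.fst _).1 p.2.2
  refine ⟨⟨fun p => ⟨F (p.1, p.2.1), hm p⟩, by fun_prop⟩, fun t => ?_,
    fun x => Subtype.ext (hF0 _), fun x => Subtype.ext (hF1 _)⟩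
  obtain ⟨k, hk, hk'⟩ := hF t
  exact ⟨homeoRestrict k hk.fst, hk.snd, fun x => Subtype.ext (hk' _)⟩

/-- The map `Mod(V_g) → Mod(S_g)` which restricts a mapping class to the boundary. -/
noncomputable def boundaryMap (g : ℕ) : ModV g →* ModS g :=
  QuotientGroup.map _ _ (restrictHom g) (restrictHom_isotopic g)

/-- The projection `π : Mod(V_g) → Out(F_g)` given by the action on `π₁(V_g, y)` and an
identification `e` of `π₁(V_g, y)` with the free group `F_g` of rank `g`. -/
noncomputable def projection {g : ℕ} {y : Handlebody g}
    (e : FundamentalGroup (Handlebody g) y ≃* FreeGroup (Fin g)) :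
    ModV g →* Out (FreeGroup (Fin g)) :=
  (outCongr e).comp (mcgOut (handlebodyHomeo g) y)

/-! ### Word length, conjugacy length and growth under surjective homomorphisms -/

section Growth

variable {G H : Type*} [Group G] [Group H]

/-! The inclusion of the boundary surface into the handlebody is surjective on fundamental groups,
and it commutes with a homeomorphism of the handlebody and its restriction. So the action on `π₁` of
the surface covers the action on `π₁` of the handlebody, up to inner automorphisms. Growth can only
drop under such an equivariant surjection (`expGrowth_le_of_surjective`): a homomorphism out of a
finitely generated group increases conjugacy lengths by at most a constant factor, the `n`-th root
of this factor tends to `1`, and every class downstairs is the image of one upstairs.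

Surjectivity needs no presentation of either group. The handlebody is a thickened planar region, and
pushing points vertically to the top sheet gives a map `r` to the boundary such that inclusion after
`r` is homotopic to the identity (`upperHomotopy`); this suffices by `pushHom_surjective`.
Equivariance is `pushHom_homeoOut`. Working with conjugacy classes makes the choices of base points
and connecting paths harmless. -/

theorem exists_word {A : Set G} (hA : Subgroup.closure A = ⊤) (w : G) :
    ∃ l : List G, (∀ a ∈ l, a ∈ A ∨ a⁻¹ ∈ A) ∧ l.prod = w := by
  have hw : w ∈ Subgroup.closure A := hA ▸ Subgroup.mem_top w
  rw [← Subgroup.mem_toSubmonoid, Subgroup.closure_toSubmonoid] at hw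
  exact Submonoid.exists_list_of_mem_closure hw

theorem exists_word_length_eq {A : Set G} (hA : Subgroup.closure A = ⊤) (w : G) :
    ∃ l : List G, (∀ a ∈ l, a ∈ A ∨ a⁻¹ ∈ A) ∧ l.prod = w ∧ l.length = wordLength A w := by
  obtain ⟨l, hl, hw⟩ := exists_word hA w
  exact Nat.sInf_mem (s := {n | ∃ l : List G, (∀ a ∈ l, a ∈ A ∨ a⁻¹ ∈ A) ∧ l.prod = w ∧
    l.length = n}) ⟨l.length, l, hl, hw, rfl⟩

theorem wordLength_prod_le {A : Set G} {l : List G} (hl : ∀ a ∈ l, a ∈ A ∨ a⁻¹ ∈ A) :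
    wordLength A l.prod ≤ l.length :=
  Nat.sInf_le ⟨l, hl, rfl, rfl⟩

theorem wordLength_one (A : Set G) : wordLength A 1 = 0 :=
  Nat.le_zero.1 (wordLength_prod_le (l := []) (by simp))

theorem wordLength_mul_le {A : Set G} (hA : Subgroup.closure A = ⊤) (v w : G) :
    wordLength A (v * w) ≤ wordLength A v + wordLength A w := by
  obtain ⟨l, hl, rfl, hl'⟩ := exists_word_length_eq hA v
  obtain ⟨m, hm, rfl, hm'⟩ := exists_word_length_eq hA w
  rw [← hl', ← hm', ← List.prod_append, ← List.length_append]
  refine wordLength_prod_le fun a ha => ?_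
  exact (List.mem_append.1 ha).elim (hl a) (hm a)

theorem wordLength_inv_le {A : Set G} (hA : Subgroup.closure A = ⊤) (w : G) :
    wordLength A w⁻¹ ≤ wordLength A w := by
  obtain ⟨l, hl, rfl, hl'⟩ := exists_word_length_eq hA w
  rw [← hl', List.prod_inv_reverse]
  refine (wordLength_prod_le fun a ha => ?_).trans (by simp)
  obtain ⟨b, hb, rfl⟩ := List.mem_map.1 (List.mem_reverse.1 ha)
  simpa using (hl b hb).symm

/-- A homomorphism from a finitely generated group is Lipschitz for the word lengths. -/
theorem exists_wordLength_map_le (φ : G →* H) {A : Set G} (hA : A.Finite)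
    (hA' : Subgroup.closure A = ⊤) {B : Set H} (hB : Subgroup.closure B = ⊤) :
    ∃ C : ℕ, 1 ≤ C ∧ ∀ w, wordLength B (φ w) ≤ C * wordLength A w := by
  obtain ⟨C, hC⟩ := (hA.image fun a => wordLength B (φ a)).bddAbove
  have hC' : ∀ a ∈ A, wordLength B (φ a) ≤ C := fun a ha => hC ⟨a, ha, rfl⟩
  have letter : ∀ a, a ∈ A ∨ a⁻¹ ∈ A → wordLength B (φ a) ≤ C + 1 := by
    rintro a (ha | ha)
    · exact (hC' a ha).trans C.le_succ
    · have := wordLength_inv_le hB (φ a⁻¹)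
      rw [map_inv, inv_inv, ← map_inv] at this
      exact (this.trans (hC' _ ha)).trans C.le_succ
  -- The bound on the letters may be `0`; adding `1` gives a positive constant, whose `n`-th roots
  -- tend to `1`.
  refine ⟨C + 1, by omega, fun w => ?_⟩
  obtain ⟨l, hl, rfl, hl'⟩ := exists_word_length_eq hA' w
  rw [← hl']
  -- The induction is over arbitrary words; minimality of the length would have to be carried along
  -- otherwise.
  clear hl'
  induction l with
  | nil => simp [wordLength_one]
  | cons a l ih =>
    rw [List.prod_cons, map_mul, List.length_cons, mul_add, mul_one, add_comm]
    exact (wordLength_mul_le hB _ _).trans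
      (add_le_add (letter a (hl a (by simp))) (ih fun b hb => hl b (by simp [hb])))

theorem exists_wordLength_eq_conjLength (A : Set G) (c : ConjClasses G) :
    ∃ w, ConjClasses.mk w = c ∧ wordLength A w = conjLength A c := by
  obtain ⟨w, rfl⟩ := ConjClasses.mk_surjective c
  obtain ⟨v, hv, hv'⟩ := Nat.sInf_mem (s := wordLength A '' (ConjClasses.mk w).carrier)
    ⟨_, w, ConjClasses.mem_carrier_mk, rfl⟩
  exact ⟨v, ConjClasses.mem_carrier_iff_mk_eq.1 hv, hv'⟩

theorem conjLength_mk_le (A : Set G) (w : G) : conjLength A (ConjClasses.mk w) ≤ wordLength A w :=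
  Nat.sInf_le ⟨w, ConjClasses.mem_carrier_mk, rfl⟩

/-- The image of a shortest representative of a class is a representative of the image class. -/
theorem conjLength_map_le (φ : G →* H) {A : Set G} {B : Set H} {C : ℕ}
    (hC : ∀ w, wordLength B (φ w) ≤ C * wordLength A w) (c : ConjClasses G) :
    conjLength B (ConjClasses.map φ c) ≤ C * conjLength A c := by
  obtain ⟨w, rfl, hw⟩ := exists_wordLength_eq_conjLength A c
  rw [← hw]
  exact (conjLength_mk_le B (φ w)).trans (hC w)

/-- For a nonzero base the power is continuous in the exponent, and `1 / n → 0`. -/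
theorem tendsto_natCast_rpow_one_div {C : ℕ} (hC : 1 ≤ C) :
    Filter.Tendsto (fun n : ℕ => (C : ℝ≥0∞) ^ ((1 : ℝ) / n)) Filter.atTop (nhds 1) := by
  have hC0 : ((C : NNReal)) ≠ 0 := by
    exact_mod_cast (Nat.one_le_iff_ne_zero.1 hC)
  have h0 : Filter.Tendsto (fun n : ℕ => (C : NNReal) ^ ((1 : ℝ) / n)) Filter.atTop
      (nhds ((C : NNReal) ^ (0 : ℝ))) :=
    tendsto_const_nhds.nnrpow (tendsto_const_div_atTop_nhds_zero_nat (1 : ℝ)) (Or.inl hC0)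
  rw [NNReal.rpow_zero] at h0
  refine (ENNReal.tendsto_coe.2 h0).congr fun n => ?_
  rw [ENNReal.coe_rpow_of_ne_zero hC0, ENNReal.coe_natCast]

/-- Exponential rates do not see multiplicative constants, so a Lipschitz bound suffices to compare
them. -/
theorem limsup_rpow_one_div_le {u v : ℕ → ℕ} {C : ℕ} (hC : 1 ≤ C) (h : ∀ n, u n ≤ C * v n) :
    Filter.limsup (fun n : ℕ => (u n : ℝ≥0∞) ^ ((1 : ℝ) / n)) Filter.atTop ≤
      Filter.limsup (fun n : ℕ => (v n : ℝ≥0∞) ^ ((1 : ℝ) / n)) Filter.atTop := by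
  have hlim := (tendsto_natCast_rpow_one_div hC).limsup_eq
  calc _ ≤ Filter.limsup ((fun n : ℕ => (C : ℝ≥0∞) ^ ((1 : ℝ) / n)) *
          fun n : ℕ => (v n : ℝ≥0∞) ^ ((1 : ℝ) / n)) Filter.atTop := by
        refine Filter.limsup_le_limsup (Filter.Eventually.of_forall fun n => ?_)
        rw [Pi.mul_apply, ← ENNReal.mul_rpow_of_nonneg _ _ (by positivity)]
        exact ENNReal.rpow_le_rpow (by exact_mod_cast h n) (by positivity)
    -- The product of the two upper limits cannot be `0 · ∞`, since the first one is `1`; the second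
    -- may be any value.
    _ ≤ _ := ENNReal.limsup_mul_le' (Or.inl (hlim ▸ one_ne_zero)) (Or.inl (hlim ▸ ENNReal.one_ne_top))
    _ = _ := by rw [hlim, one_mul]

theorem outConjClasses_pow_map {φ : G →* H} {Φ : Out G} {Ψ : Out H}
    (h : ∀ c, outConjClasses H Ψ (ConjClasses.map φ c) =
      ConjClasses.map φ (outConjClasses G Φ c)) (n : ℕ) (c : ConjClasses G) :
    outConjClasses H (Ψ ^ n) (ConjClasses.map φ c) =
      ConjClasses.map φ (outConjClasses G (Φ ^ n) c) := by
  induction n generalizing c with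
  | zero => simp
  | succ n ih => rw [pow_succ, pow_succ, map_mul, map_mul, Equiv.Perm.mul_apply,
      Equiv.Perm.mul_apply, h, ih]

/-- The growth rate does not increase under an equivariant surjective homomorphism. -/
theorem expGrowth_le_of_surjective {φ : G →* H} (hφ : Function.Surjective φ)
    {Φ : Out G} {Ψ : Out H}
    (h : ∀ c, outConjClasses H Ψ (ConjClasses.map φ c) =
      ConjClasses.map φ (outConjClasses G Φ c))
    {A : Set G} (hA : A.Finite) (hA' : Subgroup.closure A = ⊤) {B : Set H}
    (hB : Subgroup.closure B = ⊤) : expGrowth B Ψ ≤ expGrowth A Φ := by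
  obtain ⟨C, hC1, hC⟩ := exists_wordLength_map_le φ hA hA' hB
  refine iSup_le fun v => ?_
  -- Each term of the supremum over `H` is bounded by the term of a preimage in `G`.
  obtain ⟨w, rfl⟩ := hφ v
  refine le_iSup_of_le w (limsup_rpow_one_div_le hC1 fun n => ?_)
  have := conjLength_map_le φ hC (outConjClasses G (Φ ^ n) (ConjClasses.mk w))
  rwa [← outConjClasses_pow_map h] at this

theorem outConjClasses_outCongr (e : G ≃* H) (Φ : Out G) (c : ConjClasses G) :
    outConjClasses H (outCongr e Φ) (ConjClasses.map e.toMonoidHom c) =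
      ConjClasses.map e.toMonoidHom (outConjClasses G Φ c) := by
  obtain ⟨φ, rfl⟩ := QuotientGroup.mk_surjective Φ
  obtain ⟨w, rfl⟩ := ConjClasses.mk_surjective c
  exact congrArg (fun v => ConjClasses.mk (e (φ v))) (e.symm_apply_apply w)

end Growth

/-! ### Continuous maps and fundamental groups -/

section Pushforward

/-- On loops at `y`, going back and forth by `R` and `F` is conjugation by `b`, hence bijective;
changing base points along `ε` and `δ` only adds a further conjugation. -/
theorem groupoid_surjective {C D : Type*} [Groupoid C] [Groupoid D] (F : C ⥤ D) (R : D ⥤ C)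
    {x : C} {y : D} (b : y ⟶ F.obj (R.obj y)) (hb : ∀ p : y ⟶ y, p ≫ b = b ≫ F.map (R.map p))
    (ε : x ⟶ R.obj y) (δ : F.obj x ⟶ y) (p : y ⟶ y) :
    ∃ w : x ⟶ x, Groupoid.inv δ ≫ F.map w ≫ δ = p := by
  have hb' : ∀ p : y ⟶ y, F.map (R.map p) = inv b ≫ p ≫ b := fun p => by simp [← hb]
  -- With `t = δ⁻¹ ≫ F ε ≫ b⁻¹`, a loop at `y`, the element `ε ≫ R q ≫ ε⁻¹` is sent to `t ≫ q ≫
  -- t⁻¹`; so take `q = t⁻¹ ≫ p ≫ t`.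
  refine ⟨ε ≫ R.map (inv (inv δ ≫ F.map ε ≫ inv b) ≫ p ≫ inv δ ≫ F.map ε ≫ inv b) ≫ inv ε, ?_⟩
  rw [F.map_comp, F.map_comp, hb']
  simp

variable {X Y : Type*} [TopologicalSpace X] [TopologicalSpace Y]

/-- The homomorphism `p ↦ δ⁻¹ · j(p) · δ` from `π₁(X, x)` to `π₁(Y, y)` given by a continuous map
`j` and a class `δ` of paths from `j x` to `y`. -/
noncomputable def pushHom (j : C(X, Y)) {x : X} {y : Y}
    (δ : FundamentalGroupoid.mk (j x) ⟶ FundamentalGroupoid.mk y) :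
    FundamentalGroup X x →* FundamentalGroup Y y :=
  ((Groupoid.isoEquivHom _ _).symm δ).conj.toMonoidHom.comp (FundamentalGroup.map j x)

theorem groupoid_map_comp_map {Z : Type*} [TopologicalSpace Z] (f : C(Y, Z)) (g : C(X, Y)) {a b : X}
    (p : FundamentalGroupoid.mk a ⟶ FundamentalGroupoid.mk b) :
    (FundamentalGroupoid.map (f.comp g)).map p =
      (FundamentalGroupoid.map f).map ((FundamentalGroupoid.map g).map p) := by
  induction p using Path.Homotopic.Quotient.ind with
  | mk p => rfl

/-- A map with a right homotopy inverse is surjective on fundamental groups. -/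
theorem pushHom_surjective [PathConnectedSpace X] (j : C(X, Y)) (r : C(Y, X))
    (E : ContinuousMap.Homotopy (ContinuousMap.id Y) (j.comp r)) {x : X} {y : Y}
    (δ : FundamentalGroupoid.mk (j x) ⟶ FundamentalGroupoid.mk y) :
    Function.Surjective (pushHom j δ) := by
  intro p
  refine groupoid_surjective (FundamentalGroupoid.map j) (FundamentalGroupoid.map r)
    (x := FundamentalGroupoid.mk x) (y := FundamentalGroupoid.mk y)
    (pathArrow (E.evalAt y)) (fun q => ?_) (pathArrow (PathConnectedSpace.somePath x (r y))) δ p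
  have nat := (FundamentalGroupoidFunctor.homotopicMapsNatIso E).naturality q
  exact (congrArg (· ≫ _) (groupoid_map_id q)).symm.trans
    (nat.trans (congrArg (_ ≫ ·) (groupoid_map_comp_map j r q)))

/-- The two ways around the square of a functor `J` and endofunctors `K` and `L` with
`J ⋙ L = K ⋙ J` agree on a loop up to conjugation. -/
theorem groupoid_conj {C D : Type*} [Groupoid C] [Groupoid D] (J : C ⥤ D) (L : D ⥤ D)
    {x x' : C} {y : D} (q : x' ⟶ x') (γ : x' ⟶ x) (δ : J.obj x ⟶ y) {p : J.obj x ⟶ J.obj x}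
    (τ : J.obj x' ⟶ L.obj (J.obj x)) (h : J.map q ≫ τ = τ ≫ L.map p) (γ' : L.obj y ⟶ y) :
    Groupoid.inv δ ≫ J.map (Groupoid.inv γ ≫ q ≫ γ) ≫ δ =
      Groupoid.inv (Groupoid.inv γ' ≫ inv (L.map δ) ≫ inv τ ≫ J.map γ ≫ δ) ≫
        (Groupoid.inv γ' ≫ L.map (Groupoid.inv δ ≫ p ≫ δ) ≫ γ') ≫
          Groupoid.inv γ' ≫ inv (L.map δ) ≫ inv τ ≫ J.map γ ≫ δ := by
  -- The conjugator is the loop at `y` around the square: back along `γ'`, `L δ` and `τ`, then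
  -- forward along `J γ` and `δ`. Once `L p` is written through `J q`, everything cancels.
  have h' : L.map p = inv τ ≫ J.map q ≫ τ := by simp [h]
  simp [h']

/-- The homomorphism induced by a map `j` which commutes up to homotopy with homeomorphisms `k` and
`h` is equivariant on conjugacy classes. -/
theorem pushHom_homeoOut [PathConnectedSpace X] [PathConnectedSpace Y] (j : C(X, Y))
    {x : X} {y : Y} (δ : FundamentalGroupoid.mk (j x) ⟶ FundamentalGroupoid.mk y)
    (k : X ≃ₜ X) (h : Y ≃ₜ Y)
    (E : ContinuousMap.Homotopy (j.comp (k : C(X, X))) ((h : C(Y, Y)).comp j))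
    (c : ConjClasses (FundamentalGroup X x)) :
    outConjClasses _ (homeoOut y h) (ConjClasses.map (pushHom j δ) c) =
      ConjClasses.map (pushHom j δ) (outConjClasses _ (homeoOut x k) c) := by
  obtain ⟨p, rfl⟩ := ConjClasses.mk_surjective c
  -- Naturality of the homotopy at the loop `p`; the arrow `τ` is the track of the base point.
  have nat : (FundamentalGroupoid.map j).map ((FundamentalGroupoid.map (k : C(X, X))).map p) ≫
      pathArrow (E.evalAt x) = pathArrow (E.evalAt x) ≫
        (FundamentalGroupoid.map (h : C(Y, Y))).map ((FundamentalGroupoid.map j).map p) :=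
    (congrArg (· ≫ _) (groupoid_map_comp_map j (k : C(X, X)) p)).symm.trans
      (((FundamentalGroupoidFunctor.homotopicMapsNatIso E).naturality p).trans
        (congrArg (_ ≫ ·) (groupoid_map_comp_map (h : C(Y, Y)) j p)))
  -- By definition (see `conj_eq`), `c * p * c⁻¹` is `c⁻¹ ≫ p ≫ c` in the groupoid, so unification
  -- finds the conjugator.
  exact ConjClasses.mk_eq_mk_iff_isConj.2 (isConj_iff.2 ⟨_, (groupoid_conj
    (FundamentalGroupoid.map j) (FundamentalGroupoid.map (h : C(Y, Y))) _
    (pathArrow (PathConnectedSpace.somePath (k x) x)) δ (pathArrow (E.evalAt x))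
    nat (pathArrow (PathConnectedSpace.somePath (h y) y))).symm⟩)

end Pushforward

/-! ### The handlebody -/

section Handlebody

/-- The inclusion of the boundary surface into the handlebody. -/
def boundaryInclusion (g : ℕ) : C(Surface g, Handlebody g) := ⟨Subtype.val, continuous_subtype_val⟩

theorem continuous_planarHeight_val (g : ℕ) :
    Continuous fun v : Handlebody g => planarHeight g v.1.1 :=
  (continuous_planarHeight g).comp (by fun_prop)

/-- The projection of the handlebody along the vertical direction to the upper half of its
boundary. -/
noncomputable def upperProjection (g : ℕ) : C(Handlebody g, Surface g) where
  toFun v := ⟨⟨(v.1.1, √(planarHeight g v.1.1)), v.2.1,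
    (Real.sq_sqrt (planarHeight_nonneg v.2.1)).le⟩, Real.sq_sqrt (planarHeight_nonneg v.2.1)⟩
  continuous_toFun := by
    have := continuous_planarHeight_val g
    fun_prop

/-- The vertical straight-line homotopy from the identity of the handlebody to the projection to
the upper half of the boundary. -/
noncomputable def upperHomotopy (g : ℕ) :
    ContinuousMap.Homotopy (ContinuousMap.id (Handlebody g))
      ((boundaryInclusion g).comp (upperProjection g)) where
  toFun a := ⟨(a.2.1.1, (1 - (a.1 : ℝ)) * a.2.1.2 + a.1 * √(planarHeight g a.2.1.1)), a.2.2.1, by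
    have hz := abs_le.1 (Real.abs_le_sqrt a.2.2.2)
    have hq := Real.sq_sqrt (planarHeight_nonneg a.2.2.1)
    have h0 := a.1.2.1
    have h1 := a.1.2.2
    -- Both ends of the vertical segment lie in the interval from `-√q` to `√q`, which is convex.
    refine (sq_le_sq' ?_ ?_).trans_eq hq <;> nlinarith [Real.sqrt_nonneg (planarHeight g a.2.1.1)]⟩
  continuous_toFun := by
    have := (continuous_planarHeight_val g).comp (continuous_snd (X := I))
    simp only [Function.comp_def] at this
    fun_prop
  map_zero_left v := Subtype.ext (Prod.ext rfl (by simp))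
  map_one_left v := Subtype.ext (Prod.ext rfl (by simp [boundaryInclusion, upperProjection]))

end Handlebody

/-! ### Comparison of the growth rates -/

theorem mainTheorem4 (g : ℕ) (x : Surface g) (y : Handlebody g) (f : ModV g)
    (A : Set (FundamentalGroup (Surface g) x)) (hA : A.Finite) (hA' : Subgroup.closure A = ⊤) :
    (∀ B : Set (FundamentalGroup (Handlebody g) y), B.Finite → Subgroup.closure B = ⊤ →
      expGrowth B (mcgOut (handlebodyHomeo g) y f) ≤
        expGrowth A (mcgOut (surfaceHomeo g) x (boundaryMap g f))) ∧
    ∀ e : FundamentalGroup (Handlebody g) y ≃* FreeGroup (Fin g),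
      ∀ B : Set (FreeGroup (Fin g)), B.Finite → Subgroup.closure B = ⊤ →
        expGrowth B (projection e f) ≤
          expGrowth A (mcgOut (surfaceHomeo g) x (boundaryMap g f)) := by
  let δ := pathArrow (PathConnectedSpace.somePath (boundaryInclusion g x) y)
  have surj : Function.Surjective (pushHom (boundaryInclusion g) δ) :=
    pushHom_surjective _ (upperProjection g) (upperHomotopy g) δ
  have equiv : ∀ c, outConjClasses _ (mcgOut (handlebodyHomeo g) y f)
      (ConjClasses.map (pushHom (boundaryInclusion g) δ) c) =
      ConjClasses.map (pushHom (boundaryInclusion g) δ)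
        (outConjClasses _ (mcgOut (surfaceHomeo g) x (boundaryMap g f)) c) := by
    obtain ⟨h, rfl⟩ := QuotientGroup.mk_surjective f
    -- Restriction commutes with the inclusion on the nose, so the constant homotopy serves.
    exact pushHom_homeoOut (boundaryInclusion g) δ (restrictHom g h).1 h.1
      (ContinuousMap.Homotopy.refl _)
  refine ⟨fun B _ hB => expGrowth_le_of_surjective surj equiv hA hA' hB, fun e B _ hB => ?_⟩
  -- An identification with the free group is absorbed into the surjection by composing with `e`.
  refine expGrowth_le_of_surjective
    (φ := e.toMonoidHom.comp (pushHom (boundaryInclusion g) δ)) (e.surjective.comp surj)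
    (fun c => ?_) hA hA' hB
  have map_comp : ∀ c, ConjClasses.map (e.toMonoidHom.comp (pushHom (boundaryInclusion g) δ)) c =
      ConjClasses.map e.toMonoidHom (ConjClasses.map (pushHom (boundaryInclusion g) δ) c) := by
    rintro ⟨p⟩
    rfl
  rw [map_comp, map_comp, ← equiv]
  exact outConjClasses_outCongr e _ _
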